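/- **Theorem (strict completeness hierarchy).** Fix a set $\mathsf{AP}$ of atomic propositions and a non-empty set $\mathcal V$ of propositional variables; literals are $p$ and $\neg p$ for $p\in\mathsf{AP}$. Formulae of the $\mu$-calculus $\mathcal L_\mu$ are $$\varphi,\psi ::= \top \mid \bot \mid l \mid X \mid \varphi\wedge\psi \mid \varphi\vee\psi \mid \Box\varphi \mid \Diamond\varphi \mid \nu X.\varphi \mid \mu X.\varphi ,$$ with $l$ a literal and $X\in\mathcal V$. A *Kripke structure* $K=\langle S,S^0,R,L\rangle$ has states $S$, initial states $S^0\subseteq S$, transitions $R\subseteq S\times S$, and a labelling of states by sets of literals such that $L(s)$ contains exactly one of $p,\neg p$ for every $p\in\mathsf{AP}$. A *generalised Kripke modal transition system* (GTS) $M=\langle S,S^0,R^+,R^-,L\rangle$ has states $S$, initial states $S^0\subseteq S$, may transitions $R^-\subseteq S\times S$, must transitions $R^+\subseteq S\times 2^S$ such that $s\,R^+A$ implies $s\,R^-t$ for all $t\in A$, and a labelling such that $L(s)$ contains at most one of $p,\neg p$. A Kripke structure is regarded as a GTS by taking $R^-=R$ and $R^+=\{(s,\{t\}) : s\,R\,t\}$.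 On a Kripke structure, $\mathcal L_\mu$ has its standard semantics. The standard inductive semantics $\models^{SIS}$ on a GTS has the same clauses for truth ($\mu$ and $\nu$ being least and greatest fixpoints), except that $\Box\varphi$ is true at $s$ iff $\varphi$ is true at every $t$ with $s\,R^-t$, and $\Diamond\varphi$ is true at $s$ iff there is $A$ with $s\,R^+A$ such that $\varphi$ is true at all states of $A$. A structure or model satisfies a closed formula if the formula is true at all its initial states. A *mixed simulation* between GTSs $M_1,M_2$ is a relation $H\subseteq S_1\times S_2$ such that $s_1\,H\,s_2$ implies: $L_2(s_2)\subseteq L_1(s_1)$; if $s_1\,R_1^-s_1'$, then there is $s_2'$ with $s_2\,R_2^-s_2'$ and $s_1'\,H\,s_2'$; if $s_2\,R_2^+A_2$, then there is $A_1$ with $s_1\,R_1^+A_1$ such that every $s_1'\in A_1$ has some $s_2'\in A_2$ with $s_1'\,H\,s_2'$. Write $M_1\le_{mix}M_2$ if for every initial state $s_1$ of $M_1$ there are an initial state $s_2$ of $M_2$ and a mixed simulation $H$ with $s_1\,H\,s_2$. For a class $\mathcal C$ of Kripke structures, let $\mathbf{compl}(\mathcal C)$ be the set of closed formulae $\varphi\in\mathcal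 L_\mu$ that are satisfiable (true in some state of some Kripke structure) and such that for every $K\in\mathcal C$ with $K\models\varphi$ there is a GTS $M$ with finitely many states such that $K\le_{mix}M$ and $M\models^{SIS}\varphi$. Let $\mathbf{KS}$ be the class of all Kripke structures, $\mathbf{KS}_{fi}$ the class of those with finitely many initial states, and $\mathbf{KS}_{fb}$ the class of those in $\mathbf{KS}_{fi}$ in which every state has finitely many successors. Then $$\mathbf{compl}(\mathbf{KS})\subsetneq\mathbf{compl}(\mathbf{KS}_{fi})\subsetneq\mathbf{compl}(\mathbf{KS}_{fb}).$$ Moreover, for all $P\in\mathsf{AP}$ and $X\in\mathcal V$, $$\mu X.(P\vee\Diamond X)\in\mathbf{compl}(\mathbf{KS}_{fi})\setminus\mathbf{compl}(\mathbf{KS}),\qquad \mu X.\Box X\in\mathbf{compl}(\mathbf{KS}_{fb})\setminus\mathbf{compl}(\mathbf{KS}_{fi}).$$ -/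

import Mathlib

universe u v w

namespace Abstraction

/-- Literals over the atomic propositions `AP`: `p` and `¬ p`. -/
inductive Literal (AP : Type v) : Type v
  | pos (p : AP) : Literal AP
  | neg (p : AP) : Literal AP

/-- Formulae of the modal `μ`-calculus in positive form, with atomic propositions `AP` and
propositional variables `V`. -/
inductive Formula (AP : Type v) (V : Type w) : Type (max v w)
  | top : Formula AP V
  | bot : Formula AP V
  | lit (l : Literal AP) : Formula AP V
  | var (X : V) : Formula AP V
  | and (φ ψ : Formula AP V) : Formula AP V
  | or (φ ψ : Formula AP V) : Formula AP V
  | box (φ : Formula AP V) : Formula AP V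
  | dia (φ : Formula AP V) : Formula AP V
  | nu (X : V) (φ : Formula AP V) : Formula AP V
  | mu (X : V) (φ : Formula AP V) : Formula AP V

namespace Formula

variable {AP : Type v} {V : Type w}

/-- The free propositional variables of a formula. -/
def freeVars : Formula AP V → Set V
  | top => ∅
  | bot => ∅
  | lit _ => ∅
  | var X => {X}
  | and φ ψ => φ.freeVars ∪ ψ.freeVars
  | or φ ψ => φ.freeVars ∪ ψ.freeVars
  | box φ => φ.freeVars
  | dia φ => φ.freeVars
  | nu X φ => φ.freeVars \ {X}
  | mu X φ => φ.freeVars \ {X}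

/-- A formula is closed if it has no free propositional variables. -/
def IsClosed (φ : Formula AP V) : Prop := φ.freeVars = ∅

/-- The reachability formula `μ X. (P ∨ ◇ X)`. -/
def reach (P : AP) (X : V) : Formula AP V :=
  mu X (or (lit (Literal.pos P)) (dia (var X)))

/-- The termination formula `μ X. □ X`. -/
def termination (X : V) : Formula AP V :=
  mu X (box (var X))

end Formula

/-- Kripke structures over the atomic propositions `AP`. -/
structure KripkeStructure (AP : Type v) : Type (max (u + 1) v) where
  /-- the states -/
  State : Type u
  /-- the initial states -/
  init : Set State
  /-- the transition relation -/
  trans : State → State → Prop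
  /-- the labelling -/
  label : State → Set (Literal AP)
  /-- each label contains exactly one of `p` and `¬ p` -/
  label_exactly_one : ∀ s p, Xor (Literal.pos p ∈ label s) (Literal.neg p ∈ label s)

/-- Generalised Kripke modal transition systems over the atomic propositions `AP`. -/
structure GTS (AP : Type v) : Type (max (u + 1) v) where
  /-- the states -/
  State : Type u
  /-- the initial states -/
  init : Set State
  /-- the must (hyper)transitions `R⁺ ⊆ S × 2^S` -/
  must : State → Set State → Prop
  /-- the may transitions `R⁻ ⊆ S × S` -/
  may : State → State → Prop
  /-- the labelling -/
  label : State → Set (Literal AP)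
  /-- must transitions are matched by may transitions -/
  may_of_must : ∀ s A, must s A → ∀ t ∈ A, may s t
  /-- each label contains at most one of `p` and `¬ p` -/
  label_consistent : ∀ s p, ¬ (Literal.pos p ∈ label s ∧ Literal.neg p ∈ label s)

section Semantics

variable {AP : Type v} {V : Type w} {S : Type u}

open Classical in
/-- For a monotone `F` (a set of states depending on an environment `η`), the operator
`U ↦ F (η[X := U])`. -/
noncomputable def updateHom (F : (V → Set S) →o Set S) (X : V) (η : V → Set S) :
    Set S →o Set S where
  toFun U := F (Function.update η X U)
  monotone' _ _ h := F.monotone (update_le_update_iff.2 ⟨h, fun _ _ => le_rfl⟩)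

theorem updateHom_mono (F : (V → Set S) →o Set S) (X : V) : Monotone (updateHom F X) := by
  classical
  intro η η' h U
  exact F.monotone (update_le_update_iff.2 ⟨le_rfl, fun Y _ => h Y⟩)

/-- Interpretation of formulae, given the interpretation of literals and monotone interpretations
of the modalities `◇` and `□` as operators on sets of states. Every formula denotes a monotone map
from environments to sets of states; `μ` and `ν` are the least and greatest fixpoints. -/
noncomputable def interp (lab : Literal AP → Set S) (D B : Set S →o Set S) :
    Formula AP V → ((V → Set S) →o Set S)
  | .top => ⟨fun _ => Set.univ, fun _ _ _ => le_rfl⟩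
  | .bot => ⟨fun _ => ∅, fun _ _ _ => le_rfl⟩
  | .lit l => ⟨fun _ => lab l, fun _ _ _ => le_rfl⟩
  | .var X => ⟨fun η => η X, fun _ _ h => h X⟩
  | .and φ ψ => ⟨fun η => interp lab D B φ η ∩ interp lab D B ψ η, fun _ _ h =>
      Set.inter_subset_inter ((interp lab D B φ).monotone h) ((interp lab D B ψ).monotone h)⟩
  | .or φ ψ => ⟨fun η => interp lab D B φ η ∪ interp lab D B ψ η, fun _ _ h =>
      Set.union_subset_union ((interp lab D B φ).monotone h) ((interp lab D B ψ).monotone h)⟩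
  | .box φ => B.comp (interp lab D B φ)
  | .dia φ => D.comp (interp lab D B φ)
  | .nu X φ => ⟨fun η => OrderHom.gfp (updateHom (interp lab D B φ) X η), fun _ _ h =>
      OrderHom.gfp.monotone (updateHom_mono (interp lab D B φ) X h)⟩
  | .mu X φ => ⟨fun η => OrderHom.lfp (updateHom (interp lab D B φ) X η), fun _ _ h =>
      OrderHom.lfp.monotone (updateHom_mono (interp lab D B φ) X h)⟩

end Semantics

namespace KripkeStructure

variable {AP : Type v} {V : Type w} (K : KripkeStructure.{u} AP)

/-- `◇ U`: states with some successor in `U`. -/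
def diaOp : Set K.State →o Set K.State where
  toFun U := {s | ∃ t, K.trans s t ∧ t ∈ U}
  monotone' _ _ h _ := fun ⟨t, hst, ht⟩ => ⟨t, hst, h ht⟩

/-- `□ U`: states with all successors in `U`. -/
def boxOp : Set K.State →o Set K.State where
  toFun U := {s | ∀ t, K.trans s t → t ∈ U}
  monotone' _ _ h _ hs t hst := h (hs t hst)

/-- The standard semantics of the `μ`-calculus on a Kripke structure. -/
noncomputable def sem (φ : Formula AP V) : (V → Set K.State) →o Set K.State :=
  interp (fun l => {s | l ∈ K.label s}) K.diaOp K.boxOp φ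

/-- `⟨K, s⟩ ⊨ φ`. It is used for closed `φ`, where the environment is irrelevant. -/
def SatAt (s : K.State) (φ : Formula AP V) : Prop := ∀ η : V → Set K.State, s ∈ K.sem φ η

/-- `K ⊨ φ`: the formula is true in all initial states. -/
def Sat (φ : Formula AP V) : Prop := ∀ s ∈ K.init, K.SatAt s φ

/-- A Kripke structure viewed as a generalised Kripke modal transition system:
`s R⁺ {t}` iff `s R⁻ t` iff `s R t`. -/
def toGTS : GTS.{u} AP where
  State := K.State
  init := K.init
  must s A := ∃ t, K.trans s t ∧ A = {t}
  may := K.trans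
  label := K.label
  may_of_must := by
    rintro s A ⟨t, hst, rfl⟩ t' ht'
    rw [Set.mem_singleton_iff.1 ht']
    exact hst
  label_consistent s p h := by
    rcases K.label_exactly_one s p with h' | h'
    · exact h'.2 h.2
    · exact h'.2 h.1

end KripkeStructure

namespace GTS

variable {AP : Type v} {V : Type w} (M : GTS.{u} AP)

/-- `◇ U`: states with a must hypertransition into a subset of `U`. -/
def diaOp : Set M.State →o Set M.State where
  toFun U := {s | ∃ A, M.must s A ∧ A ⊆ U}
  monotone' _ _ h _ := fun ⟨A, hsA, hA⟩ => ⟨A, hsA, hA.trans h⟩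

/-- `□ U`: states with all may successors in `U`. -/
def boxOp : Set M.State →o Set M.State where
  toFun U := {s | ∀ t, M.may s t → t ∈ U}
  monotone' _ _ h _ hs t hst := h (hs t hst)

/-- The truth part `⟦φ⟧_tt` of the standard inductive semantics. -/
noncomputable def semTrue (φ : Formula AP V) : (V → Set M.State) →o Set M.State :=
  interp (fun l => {s | l ∈ M.label s}) M.diaOp M.boxOp φ

/-- `⟨M, s⟩ ⊨ φ` in the standard inductive semantics. It is used for closed `φ`, where the
environment is irrelevant. -/
def SatAt (s : M.State) (φ : Formula AP V) : Prop := ∀ η : V → Set M.State, s ∈ M.semTrue φ η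

/-- `M ⊨ φ` in the standard inductive semantics: the formula is true in all initial states. -/
def Sat (φ : Formula AP V) : Prop := ∀ s ∈ M.init, M.SatAt s φ

/-- Mixed simulations between two generalised Kripke modal transition systems. -/
structure IsMixedSimulation (M₁ M₂ : GTS.{u} AP) (H : M₁.State → M₂.State → Prop) : Prop where
  label_subset : ∀ s₁ s₂, H s₁ s₂ → M₂.label s₂ ⊆ M₁.label s₁
  may_forth : ∀ s₁ s₂, H s₁ s₂ → ∀ s₁', M₁.may s₁ s₁' → ∃ s₂', M₂.may s₂ s₂' ∧ H s₁' s₂'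
  must_back : ∀ s₁ s₂, H s₁ s₂ → ∀ A₂, M₂.must s₂ A₂ →
    ∃ A₁, M₁.must s₁ A₁ ∧ ∀ s₁' ∈ A₁, ∃ s₂' ∈ A₂, H s₁' s₂'

/-- `⟨M₁, s₁⟩ ≤_mix ⟨M₂, s₂⟩`. -/
def MixLEAt (M₁ M₂ : GTS.{u} AP) (s₁ : M₁.State) (s₂ : M₂.State) : Prop :=
  ∃ H, IsMixedSimulation M₁ M₂ H ∧ H s₁ s₂

/-- `M₁ ≤_mix M₂`: every initial state of `M₁` is mixed simulated by an initial state of `M₂`. -/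
def MixLE (M₁ M₂ : GTS.{u} AP) : Prop :=
  ∀ s₁ ∈ M₁.init, ∃ s₂ ∈ M₂.init, MixLEAt M₁ M₂ s₁ s₂

end GTS

/-- A closed formula is satisfiable if it is true in some state of some Kripke structure. -/
def Satisfiable {AP : Type v} {V : Type w} (φ : Formula AP V) : Prop :=
  ∃ (K : KripkeStructure.{u} AP) (s : K.State), K.SatAt s φ

/-- Abstraction formalisms: a class of Kripke structures, a class of abstract models, a refinement
relation between Kripke structures and abstract models, and a satisfaction relation on the
abstract models. -/
structure AbstractionFormalism (AP : Type v) (V : Type w) where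
  /-- the class of concrete structures -/
  concrete : Set (KripkeStructure.{u} AP)
  /-- the class of abstract models -/
  Model : Type (max (u + 1) v)
  /-- the refinement relation -/
  refines : KripkeStructure.{u} AP → Model → Prop
  /-- the satisfaction relation on abstract models -/
  sat : Model → Formula AP V → Prop

/-- The completeness set of an abstraction formalism: the satisfiable closed formulae which, on each
concrete structure where they hold, can be proved with an abstract model. -/
def compl {AP : Type v} {V : Type w} (F : AbstractionFormalism.{u} AP V) : Set (Formula AP V) :=
  {φ | φ.IsClosed ∧ Satisfiable.{u} φ ∧
    ∀ K ∈ F.concrete, K.Sat φ → ∃ M : F.Model, F.refines K M ∧ F.sat M φ}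

/-- The formalism `⟨C, GTS, ≤_mix, ⊨^SIS⟩` with finite abstract models. -/
def gtsFormalism {AP : Type v} (V : Type w) (C : Set (KripkeStructure.{u} AP)) :
    AbstractionFormalism.{u} AP V where
  concrete := C
  Model := {M : GTS.{u} AP // Finite M.State}
  refines K M := GTS.MixLE K.toGTS M.1
  sat M φ := M.1.Sat φ

/-- The class of all Kripke structures. -/
def KS (AP : Type v) : Set (KripkeStructure.{u} AP) := Set.univ

/-- The class of Kripke structures with finitely many initial states. -/
def KSfi (AP : Type v) : Set (KripkeStructure.{u} AP) := {K | K.init.Finite}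

/-- The class of finitely branching Kripke structures with finitely many initial states. -/
def KSfb (AP : Type v) : Set (KripkeStructure.{u} AP) :=
  {K | K ∈ KSfi AP ∧ ∀ s, {t | K.trans s t}.Finite}

end Abstraction

namespace Abstraction

/-! In a finite model every least fixpoint closes at some finite stage `k`
(`exists_lfp_le_iterate`), and mixed simulations carry stages back to the concrete side: a state
simulated by a member of stage `k` has rank below `k` (`lt_of_mem_iterate_reachOp`,
`lt_of_mem_iterate_boxOp`). So no finite model proves the formula when the ranks of initial states
are unbounded (a chain with all states initial) or one of them is infinite (a single root above the
whole chain).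

Conversely, a common bound `N` on the ranks of initial states yields a finite model with one state
per rank (`mixLE_ladder`, `mixLE_countdown`). For reachability the rank is the length of a path,
always finite, so finitely many initial states suffice; for termination it can be transfinite, and
finite branching is what makes it finite (`exists_mem_iterate_boxOp`). The inclusions are
antitonicity of `compl` in the class of structures. -/

theorem exists_uniform_bound {α : Type*} {s : Set α} (hs : s.Finite) {p : α → ℕ → Prop}
    (h : ∀ x ∈ s, ∃ n, p x n) : ∃ N, ∀ x ∈ s, ∃ n ≤ N, p x n := by
  classical
  choose! f hf using h
  obtain ⟨N, hN⟩ := (hs.image f).bddAbove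
  exact ⟨N, fun x hx => ⟨f x, hN ⟨x, hx, rfl⟩, hf x hx⟩⟩

/-- On a finite set of states, a least fixpoint is reached after finitely many iterations. -/
theorem exists_lfp_le_iterate {S : Type*} [Finite S] (F : Set S →o Set S) :
    ∃ k, OrderHom.lfp F ≤ F^[k] ⊥ := by
  have hmono : Monotone fun n => F^[n] (⊥ : Set S) :=
    Monotone.monotone_iterate_of_le_map F.monotone bot_le
  obtain ⟨k, hk⟩ := WellFoundedGT.monotone_chain_condition ⟨_, hmono⟩
  refine ⟨k, OrderHom.lfp_le F ?_⟩
  have h := hk (k + 1) k.le_succ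
  simp only [OrderHom.coe_mk, Function.iterate_succ_apply'] at h
  exact h.ge

/-! ### Least fixpoints of the two formulas as semantic operators -/

section Reachability

variable {AP : Type v} {V : Type w} {S : Type u}

/-- The operator `U ↦ G ∪ ◇ U`. -/
def reachOp (G : Set S) (D : Set S →o Set S) : Set S →o Set S where
  toFun U := G ∪ D U
  monotone' _ _ h := Set.union_subset_union_right G (D.monotone h)

/-- The formula `μ X. (γ ∨ ◇ X)`: a state satisfying `γ` is reachable. -/
def Formula.eventually (γ : Formula AP V) (X : V) : Formula AP V :=
  .mu X (.or γ (.dia (.var X)))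

theorem updateHom_interp_var (lab : Literal AP → Set S) (D B : Set S →o Set S) (X : V)
    (η : V → Set S) (U : Set S) : updateHom (interp lab D B (.var X)) X η U = U := by
  classical
  exact Function.update_self (β := fun _ => Set S) X U η

/-- By `hγ` the goal ignores the environment, so only the diamond sees the update at `X`. Stated for
`interp`, this serves Kripke structures and models alike. -/
theorem interp_eventually (lab : Literal AP → Set S) (D B : Set S →o Set S) (γ : Formula AP V)
    (X : V) (η : V → Set S) (G : Set S) (hγ : ∀ η', interp lab D B γ η' = G) :
    interp lab D B (γ.eventually X) η = OrderHom.lfp (reachOp G D) := by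
  refine congrArg OrderHom.lfp (OrderHom.ext _ _ (funext fun U => ?_))
  change interp lab D B γ _ ∪ D (_) = G ∪ D U
  rw [hγ]
  exact congrArg (fun W => G ∪ D W) (updateHom_interp_var lab D B X η U)

theorem interp_termination (lab : Literal AP → Set S) (D B : Set S →o Set S) (X : V)
    (η : V → Set S) : interp lab D B (Formula.termination X) η = OrderHom.lfp B := by
  refine congrArg OrderHom.lfp (OrderHom.ext _ _ (funext fun U => ?_))
  change B (_) = B U
  exact congrArg B (updateHom_interp_var lab D B X η U)

end Reachability

/-! ### Unbounded distances defeat finite models -/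

section Chain

variable {AP : Type v} {V : Type w}

/-- The Kripke structure `⋯ → 2 → 1 → 0`, in which exactly the state `0` satisfies all atomic
propositions. -/
def chain (AP : Type v) (I : Set ℕ) : KripkeStructure.{u} AP where
  State := ULift ℕ
  init := {s | s.down ∈ I}
  trans s t := s.down = t.down + 1
  label s := {l | ∃ p, (s.down = 0 ∧ l = .pos p) ∨ (s.down ≠ 0 ∧ l = .neg p)}
  label_exactly_one s p := by
    by_cases h : s.down = 0 <;> simp [h, Xor]

/-- If states in the goal set `G` of a model abstract only the chain state `0`, then states reaching
`G` within fewer than `k` steps abstract only chain states below `k`. -/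
theorem lt_of_mem_iterate_reachOp {I : Set ℕ} {M : GTS.{u} AP} {G : Set M.State}
    {H : (chain AP I).State → M.State → Prop}
    (hH : GTS.IsMixedSimulation (chain AP I).toGTS M H)
    (hG : ∀ s m, H s m → m ∈ G → s.down = 0) (k : ℕ) :
    ∀ s m, H s m → m ∈ (reachOp G M.diaOp)^[k] ⊥ → s.down < k := by
  induction k with
  | zero => intro s m _ h; exact h.elim
  | succ k ih =>
    intro s m hsm h
    rw [Function.iterate_succ_apply'] at h
    rcases h with h | ⟨A, hmA, hA⟩
    · rw [hG s m hsm h]; exact k.succ_pos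
    · obtain ⟨A₁, ⟨t, hst, rfl⟩, hback⟩ := hH.must_back s m hsm A hmA
      obtain ⟨m', hm', htm'⟩ := hback t rfl
      have := ih t m' htm' (hA hm')
      have hst' : s.down = t.down + 1 := hst
      omega

theorem mem_lfp_reachOp_chain {I : Set ℕ} {G : Set (chain.{u} AP I).State} (hG : ⟨0⟩ ∈ G) (n : ℕ) :
    ⟨n⟩ ∈ OrderHom.lfp (reachOp G (chain.{u} AP I).diaOp) := by
  induction n with
  | zero => rw [← OrderHom.map_lfp]; exact Or.inl hG
  | succ n ih => rw [← OrderHom.map_lfp]; exact Or.inr ⟨⟨n⟩, rfl, ih⟩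

/-- Reachability of a goal that singles out the state `0` of a chain cannot be proved by a finite
model on the chain all of whose states are initial. -/
theorem eventually_notMem_compl_KS (γ : Formula AP V) (X : V)
    (gK : Set (chain.{u} AP Set.univ).State) (hgK : ∀ η, (chain AP Set.univ).sem γ η = gK)
    (h0 : ⟨0⟩ ∈ gK) (gM : ∀ M : GTS.{u} AP, Set M.State)
    (hgM : ∀ M : GTS.{u} AP, ∀ η, M.semTrue γ η = gM M)
    (hsim : ∀ (M : GTS.{u} AP) H, GTS.IsMixedSimulation (chain AP Set.univ).toGTS M H →
      ∀ s m, H s m → m ∈ gM M → s.down = 0) :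
    γ.eventually X ∉ compl (gtsFormalism V (KS.{u} AP)) := by
  rintro ⟨-, -, h⟩
  obtain ⟨⟨M, hfin⟩, href, hsat⟩ := h (chain AP Set.univ) (Set.mem_univ _) (by
    rintro ⟨n⟩ - η
    rw [KripkeStructure.sem, interp_eventually _ _ _ _ _ _ gK hgK]
    exact mem_lfp_reachOp_chain h0 n)
  obtain ⟨k, hk⟩ := exists_lfp_le_iterate (reachOp (gM M) M.diaOp)
  -- Since every chain state is initial, the state can be chosen after the closure stage `k` of the
  -- model is known.
  obtain ⟨m, hm, H, hH, hkm⟩ := href ⟨k⟩ trivial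
  have hmem := hsat m hm fun _ => ∅
  rw [GTS.semTrue, interp_eventually _ _ _ _ _ _ (gM M) (hgM M)] at hmem
  exact (lt_irrefl k) (lt_of_mem_iterate_reachOp hH (hsim M H hH) k _ m hkm (hk hmem))

end Chain

/-! ### Finite models for reachability -/

section Ladder

variable {AP : Type v} {V : Type w}

/-- The finite model with rungs `N, …, 1, 0`, each of the positive ones with a must transition to
the next rung, and with one more state standing for everything else. The rung `0` is labelled with
the atomic propositions in `Q`, and it is a dead end if `moves` fails. -/
def ladder (N : ℕ) (Q : Set AP) (moves : Prop) : GTS.{u} AP where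
  State := ULift (Option (Fin (N + 1)))
  init := {s | ∃ i, s = ⟨some i⟩}
  must s A := ∃ i j : Fin (N + 1), s = ⟨some i⟩ ∧ i.val = j.val + 1 ∧ A = {⟨some j⟩}
  may s _ := s = ⟨some 0⟩ → moves
  label s := {l | s = ⟨some 0⟩ ∧ ∃ p ∈ Q, l = .pos p}
  may_of_must := by
    rintro s A ⟨i, j, rfl, hij, -⟩ t - h
    simp only [ULift.up.injEq, Option.some.injEq] at h
    simp [h] at hij
  label_consistent := by
    rintro s p ⟨-, -, q, -, h⟩
    cases h

/-- The states with a path of length `n` into `G`. -/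
def reachLevel (K : KripkeStructure.{u} AP) (G : Set K.State) (n : ℕ) : Set K.State :=
  K.diaOp^[n] G

/-- The union of all levels is already closed under the operator, because a diamond needs only one
successor; no bound on branching enters. -/
theorem exists_mem_reachLevel (K : KripkeStructure.{u} AP) (G : Set K.State) {s : K.State}
    (hs : s ∈ OrderHom.lfp (reachOp G K.diaOp)) : ∃ n, s ∈ reachLevel K G n := by
  have h : OrderHom.lfp (reachOp G K.diaOp) ≤ {s | ∃ n, s ∈ reachLevel K G n} := by
    refine OrderHom.lfp_le _ ?_
    rintro s (h | ⟨t, hst, n, hn⟩)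
    · exact ⟨0, h⟩
    · refine ⟨n + 1, ?_⟩
      rw [reachLevel, Function.iterate_succ_apply']
      exact ⟨t, hst, hn⟩
  exact h hs

/-- Rung `i` abstracts the states with a path of length exactly `i` into `G`, and the must step down
a rung follows such a path. `Q` and `moves` record what the goal forces on the lowest rung. -/
theorem mixLE_ladder (K : KripkeStructure.{u} AP) (G : Set K.State) (N : ℕ) (Q : Set AP)
    (moves : Prop) (hQ : ∀ s ∈ G, ∀ p ∈ Q, Literal.pos p ∈ K.label s)
    (hmoves : ∀ s ∈ G, ∀ t, K.trans s t → moves)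
    (hN : ∀ s ∈ K.init, ∃ n ≤ N, s ∈ reachLevel K G n) :
    GTS.MixLE K.toGTS (ladder N Q moves) := by
  intro s hs
  obtain ⟨n, hnN, hn⟩ := hN s hs
  refine ⟨⟨some ⟨n, by omega⟩⟩, ⟨_, rfl⟩,
    -- The condition is vacuous at `none`, which therefore simulates every state and absorbs all may
    -- transitions.
    fun s m => ∀ i : Fin (N + 1), m = ⟨some i⟩ → s ∈ reachLevel K G i, ⟨?_, ?_, ?_⟩, ?_⟩
  · rintro s m hsm l ⟨rfl, p, hp, rfl⟩
    exact hQ s (hsm 0 rfl) p hp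
  · intro s m hsm t hst
    refine ⟨⟨none⟩, ?_, fun i hi => by cases hi⟩
    rintro rfl
    exact hmoves s (hsm 0 rfl) t hst
  · rintro s m hsm A ⟨i, j, rfl, hij, rfl⟩
    have h := hsm i rfl
    rw [hij, reachLevel, Function.iterate_succ_apply'] at h
    obtain ⟨t, hst, ht⟩ := h
    refine ⟨{t}, ⟨t, hst, rfl⟩, ?_⟩
    rintro _ rfl
    refine ⟨_, rfl, ?_⟩
    rintro i' h'
    cases h'
    exact ht
  · rintro i h'
    cases h'
    exact hn

theorem mem_lfp_reachOp_ladder (N : ℕ) (Q : Set AP) (moves : Prop)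
    (G : Set (ladder.{u} N Q moves).State) (hG : ⟨some 0⟩ ∈ G) (n : ℕ) (hn : n < N + 1) :
    ⟨some ⟨n, hn⟩⟩ ∈ OrderHom.lfp (reachOp G (ladder.{u} N Q moves).diaOp) := by
  induction n with
  | zero => rw [← OrderHom.map_lfp]; exact Or.inl hG
  | succ n ih =>
    rw [← OrderHom.map_lfp]
    refine Or.inr ⟨_, ⟨_, ⟨n, by omega⟩, rfl, rfl, rfl⟩, ?_⟩
    rintro _ rfl
    exact ih _

/-- Reachability of a goal that holds at the lowest rung of a ladder is provable by finite
models on structures with finitely many initial states. -/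
theorem eventually_mem_compl_KSfi (γ : Formula AP V) (X : V) (hclosed : γ.freeVars = ∅)
    (gK : ∀ K : KripkeStructure.{u} AP, Set K.State) (hgK : ∀ K η, K.sem γ η = gK K)
    (h0 : ⟨0⟩ ∈ gK (chain AP Set.univ)) (Q : Set AP) (moves : Prop)
    (gM : ∀ N, Set (ladder.{u} N Q moves).State)
    (hgM : ∀ N η, (ladder.{u} N Q moves).semTrue γ η = gM N) (hG : ∀ N, ⟨some 0⟩ ∈ gM N)
    (hQ : ∀ K, ∀ s ∈ gK K, ∀ p ∈ Q, Literal.pos p ∈ K.label s)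
    (hmoves : ∀ K, ∀ s ∈ gK K, ∀ t, K.trans s t → moves) :
    γ.eventually X ∈ compl (gtsFormalism V (KSfi.{u} AP)) := by
  refine ⟨?_, ⟨chain AP Set.univ, ⟨0⟩, fun η => ?_⟩, fun K hK hsat => ?_⟩
  · simp [Formula.IsClosed, Formula.eventually, Formula.freeVars, hclosed]
  · rw [KripkeStructure.sem, interp_eventually _ _ _ _ _ _ _ (hgK _)]
    exact mem_lfp_reachOp_chain h0 0
  · obtain ⟨N, hN⟩ := exists_uniform_bound (p := fun s n => s ∈ reachLevel K (gK K) n) hK (by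
      intro s hs
      have h := hsat s hs fun _ => ∅
      rw [KripkeStructure.sem, interp_eventually _ _ _ _ _ _ _ (hgK _)] at h
      exact exists_mem_reachLevel K _ h)
    refine ⟨⟨ladder N Q moves, inferInstanceAs (Finite (ULift (Option (Fin (N + 1)))))⟩,
      mixLE_ladder K _ N Q moves (hQ K) (hmoves K) hN, ?_⟩
    rintro _ ⟨i, rfl⟩ η
    rw [GTS.semTrue, interp_eventually _ _ _ _ _ _ _ (hgM N)]
    exact mem_lfp_reachOp_ladder N Q moves _ (hG N) i i.2

end Ladder

/-! ### Two instances of the goal: an atomic proposition and a dead end -/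

section Goals

variable {AP : Type v} {V : Type w}

theorem reach_mem_diff (P : AP) (X : V) :
    Formula.reach P X ∈
      compl (gtsFormalism V (KSfi.{u} AP)) \ compl (gtsFormalism V (KS.{u} AP)) := by
  refine ⟨eventually_mem_compl_KSfi (.lit (.pos P)) X rfl (fun K => {s | .pos P ∈ K.label s})
      (fun _ _ => rfl) ⟨P, .inl ⟨rfl, rfl⟩⟩ {P} True _ (fun _ _ => rfl) (fun _ => ?_) ?_
      fun _ _ _ _ _ => trivial,
    eventually_notMem_compl_KS (.lit (.pos P)) X _ (fun _ => rfl) ⟨P, .inl ⟨rfl, rfl⟩⟩ _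
      (fun _ _ => rfl) ?_⟩
  · exact ⟨rfl, P, rfl, rfl⟩
  · rintro K s hs _ rfl
    exact hs
  · intro M H hH s m hsm hm
    obtain ⟨p, h | h⟩ := hH.label_subset s m hsm hm
    · exact h.1
    · cases h.2

/-- The formula `μ X. (□ ⊥ ∨ ◇ X)` (a dead end is reachable) separates the first two completeness
sets, even without atomic propositions. -/
theorem eventually_box_bot_mem_diff (X : V) :
    (Formula.eventually (.box .bot) X : Formula AP V) ∈
      compl (gtsFormalism V (KSfi.{u} AP)) \ compl (gtsFormalism V (KS.{u} AP)) := by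
  -- Dead ends have arbitrary labels and no successors, hence `Q = ∅` and `moves = False`.
  refine ⟨eventually_mem_compl_KSfi (.box .bot) X rfl (fun K => K.boxOp ∅)
      (fun _ _ => rfl) ?_ ∅ False (fun _ => GTS.boxOp _ ∅)
      (fun _ _ => rfl) (fun _ => ?_)
      (fun _ _ _ _ h => h.elim) fun K s hs t hst => hs t hst,
    eventually_notMem_compl_KS (.box .bot) X (KripkeStructure.boxOp _ ∅) (fun _ => rfl) ?_ (fun M => M.boxOp ∅)
      (fun _ _ => rfl) ?_⟩
  · intro t (ht : 0 = t.down + 1)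
    omega
  · intro t ht
    exact ht rfl
  · intro t (ht : 0 = t.down + 1)
    omega
  · rintro M H hH ⟨_ | n⟩ m hsm hm
    · rfl
    · obtain ⟨m', hm', -⟩ := hH.may_forth _ m hsm ⟨n⟩ rfl
      exact (hm m' hm').elim

end Goals

/-! ### Termination and finite branching -/

section Termination

variable {AP : Type v} {V : Type w}

/-- The chain `⋯ → 2 → 1 → 0` together with an initial state that has a transition to each of its
states. -/
def rootedChain (AP : Type v) : KripkeStructure.{u} AP where
  State := ULift (WithTop ℕ)
  init := {⟨⊤⟩}
  trans s t := t.down < s.down ∧ t.down ≠ ⊤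
  label _ := {l | ∃ p, l = .pos p}
  label_exactly_one s p := by simp [Xor]

theorem lfp_boxOp_rootedChain (s : (rootedChain.{u} AP).State) :
    s ∈ OrderHom.lfp (rootedChain.{u} AP).boxOp := by
  obtain ⟨a⟩ := s
  induction a using WellFoundedLT.induction with
  | _ a ih =>
    rw [← OrderHom.map_lfp]
    exact fun t ht => ih t.down ht.1

/-- A state not below `k + 1` has a transition to `k`, whose abstraction would lie in stage `k`,
giving `k < k`. This covers `⊤` too, so nothing in a finite stage simulates the root. -/
theorem lt_of_mem_iterate_boxOp {M : GTS.{u} AP} {H : (rootedChain AP).State → M.State → Prop}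
    (hH : GTS.IsMixedSimulation (rootedChain AP).toGTS M H) (k : ℕ) :
    ∀ s m, H s m → m ∈ M.boxOp^[k] ⊥ → s.down < k := by
  induction k with
  | zero => intro s m _ h; exact h.elim
  | succ k ih =>
    intro s m hsm h
    rw [Function.iterate_succ_apply'] at h
    by_contra! hs
    obtain ⟨m', hm', hkm'⟩ := hH.may_forth s m hsm ⟨(k : WithTop ℕ)⟩
      ⟨lt_of_lt_of_le (by exact_mod_cast k.lt_succ_self) hs, WithTop.natCast_ne_top k⟩
    exact lt_irrefl _ (ih _ m' hkm' (h m' hm'))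

theorem termination_notMem_compl_KSfi (X : V) :
    Formula.termination X ∉ compl (gtsFormalism V (KSfi.{u} AP)) := by
  rintro ⟨-, -, h⟩
  obtain ⟨⟨M, hfin⟩, href, hsat⟩ := h (rootedChain AP) (Set.finite_singleton _) (by
    rintro s - η
    rw [KripkeStructure.sem, interp_termination]
    exact lfp_boxOp_rootedChain s)
  obtain ⟨k, hk⟩ := exists_lfp_le_iterate M.boxOp
  obtain ⟨m, hm, H, hH, hkm⟩ := href ⟨⊤⟩ rfl
  have hmem := hsat m hm fun _ => ∅
  rw [GTS.semTrue, interp_termination] at hmem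
  exact not_top_lt (lt_of_mem_iterate_boxOp hH k _ m hkm (hk hmem))

/-- The finite model with states `0, …, N` and may transitions to all smaller states. -/
def countdown (AP : Type v) (N : ℕ) : GTS.{u} AP where
  State := ULift (Fin (N + 1))
  init := Set.univ
  must _ _ := False
  may s t := t.down < s.down
  label _ := ∅
  may_of_must _ _ h := h.elim
  label_consistent _ _ h := h.1

theorem lfp_boxOp_countdown (N : ℕ) (s : (countdown.{u} AP N).State) :
    s ∈ OrderHom.lfp (countdown.{u} AP N).boxOp := by
  obtain ⟨a⟩ := s
  induction a using WellFoundedLT.induction with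
  | _ a ih =>
    rw [← OrderHom.map_lfp]
    exact fun t ht => ih t.down ht

/-- Model state `n` abstracts stage `n` of the box iteration. Must transitions and labels are not
needed, as the formula uses neither diamonds nor literals. -/
theorem mixLE_countdown (K : KripkeStructure.{u} AP) (N : ℕ)
    (hN : ∀ s ∈ K.init, ∃ n ≤ N, s ∈ K.boxOp^[n] ⊥) : GTS.MixLE K.toGTS (countdown AP N) := by
  intro s hs
  obtain ⟨n, hnN, hn⟩ := hN s hs
  refine ⟨⟨⟨n, by omega⟩⟩, trivial, fun s m => s ∈ K.boxOp^[m.down.val] ⊥, ⟨?_, ?_, ?_⟩, hn⟩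
  · exact fun _ _ _ => Set.empty_subset _
  · rintro s ⟨⟨_ | i, hi⟩⟩ hsm t hst
    -- Stage `0` is empty, so model state `0` simulates nothing; concrete dead ends first appear at
    -- stage `1`.
    · exact hsm.elim
    · simp only [Function.iterate_succ_apply'] at hsm
      exact ⟨⟨⟨i, by omega⟩⟩, Fin.mk_lt_mk.2 i.lt_succ_self, hsm t hst⟩
  · exact fun _ _ _ _ h => h.elim

/-- In a finitely branching structure, terminating states have bounded depth. -/
theorem exists_mem_iterate_boxOp (K : KripkeStructure.{u} AP) (hK : ∀ s, {t | K.trans s t}.Finite)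
    {s : K.State} (hs : s ∈ OrderHom.lfp K.boxOp) : ∃ n, s ∈ K.boxOp^[n] ⊥ := by
  have hmono : Monotone fun n => K.boxOp^[n] (⊥ : Set K.State) :=
    Monotone.monotone_iterate_of_le_map K.boxOp.monotone bot_le
  have h : OrderHom.lfp K.boxOp ≤ {s | ∃ n, s ∈ K.boxOp^[n] ⊥} := by
    refine OrderHom.lfp_le _ fun s hs => ?_
    obtain ⟨N, hN⟩ := exists_uniform_bound (hK s) hs
    refine ⟨N + 1, ?_⟩
    rw [Function.iterate_succ_apply']
    intro t hst
    obtain ⟨n, hn, ht⟩ := hN t hst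
    exact hmono hn ht
  exact h hs

theorem termination_mem_compl_KSfb (X : V) :
    Formula.termination X ∈ compl (gtsFormalism V (KSfb.{u} AP)) := by
  refine ⟨?_, ⟨rootedChain AP, ⟨⊤⟩, fun η => ?_⟩, fun K hK hsat => ?_⟩
  · simp [Formula.IsClosed, Formula.termination, Formula.freeVars]
  · rw [KripkeStructure.sem, interp_termination]
    exact lfp_boxOp_rootedChain _
  · obtain ⟨N, hN⟩ := exists_uniform_bound (p := fun s n => s ∈ K.boxOp^[n] ⊥) hK.1 (by
      intro s hs
      have h := hsat s hs fun _ => ∅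
      rw [KripkeStructure.sem, interp_termination] at h
      exact exists_mem_iterate_boxOp K hK.2 h)
    refine ⟨⟨countdown AP N, inferInstanceAs (Finite (ULift (Fin (N + 1))))⟩,
      mixLE_countdown K N hN, ?_⟩
    intro s _ η
    rw [GTS.semTrue, interp_termination]
    exact lfp_boxOp_countdown N s

end Termination

theorem compl_gtsFormalism_anti {AP : Type v} {V : Type w} {C C' : Set (KripkeStructure.{u} AP)}
    (h : C ⊆ C') : compl (gtsFormalism V C') ⊆ compl (gtsFormalism V C) :=
  fun _ hφ => ⟨hφ.1, hφ.2.1, fun K hK => hφ.2.2 K (h hK)⟩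

end Abstraction

theorem mainTheorem3 (AP : Type v) (V : Type w) [Nonempty V] :
    Abstraction.compl (Abstraction.gtsFormalism V (Abstraction.KS.{u} AP)) ⊂
        Abstraction.compl (Abstraction.gtsFormalism V (Abstraction.KSfi.{u} AP)) ∧
      Abstraction.compl (Abstraction.gtsFormalism V (Abstraction.KSfi.{u} AP)) ⊂
        Abstraction.compl (Abstraction.gtsFormalism V (Abstraction.KSfb.{u} AP)) ∧
      (∀ (P : AP) (X : V),
        Abstraction.Formula.reach P X ∈
          Abstraction.compl (Abstraction.gtsFormalism V (Abstraction.KSfi.{u} AP)) \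
            Abstraction.compl (Abstraction.gtsFormalism V (Abstraction.KS.{u} AP))) ∧
      (∀ X : V,
        Abstraction.Formula.termination X ∈
          Abstraction.compl (Abstraction.gtsFormalism V (Abstraction.KSfb.{u} AP)) \
            Abstraction.compl (Abstraction.gtsFormalism V (Abstraction.KSfi.{u} AP))) := by
  obtain ⟨X₀⟩ := ‹Nonempty V›
  refine ⟨⟨Abstraction.compl_gtsFormalism_anti (Set.subset_univ _), fun h => ?_⟩,
    ⟨Abstraction.compl_gtsFormalism_anti fun _ hK => hK.1, fun h => ?_⟩,
    Abstraction.reach_mem_diff,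
    fun X => ⟨Abstraction.termination_mem_compl_KSfb X,
      Abstraction.termination_notMem_compl_KSfi X⟩⟩
  -- `AP` may be empty, so the separating formula here must avoid atomic propositions.
  · have hX := Abstraction.eventually_box_bot_mem_diff.{u} (AP := AP) X₀
    exact hX.2 (h hX.1)
  · exact Abstraction.termination_notMem_compl_KSfi X₀
      (h (Abstraction.termination_mem_compl_KSfb X₀))
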